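/- Let $G=(U,W;E)$ be a finite bipartite graph, parallel edges allowed, and let $E(v)$ be the set of edges incident to an agent $v\in U\cup W$. Every agent $v$ has a valuation $p_v:E(v)\to\mathbb{R}_{\ge 0}$ and a value $p_v(\emptyset)\le 0$ for being unmatched; for every edge $e$ and endpoint $v$ of $e$ a threshold $\gamma_e^v>0$ is given. A matching is a set $M\subseteq E$ with $|M\cap E(v)|\le 1$ for all $v$; $M(v)$ is the edge of $M$ at $v$, or $\emptyset$ if there is none. A matching $M$ is *$\gamma$-min stable* if there is no edge $e\notin M$ with $p_v(e)\ge p_v(M(v))+\gamma_e^v$ for both endpoints $v$ of $e$, and *weakly stable* if there is no edge $e\notin M$ with $p_v(e)>p_v(M(v))$ for both endpoints $v$ of $e$. For matchings $M,N$ let $\mathrm{vote}^\gamma_v(M,N)$ be $0$ if $M(v)=N(v)$; $-1$ if $M(v)\ne N(v)\neq\emptyset$ and $p_v(N(v))\ge p_v(M(v))+\gamma_{N(v)}^v$; and $+1$ otherwise. Let $\mathrm{vote}^{weak}_v(M,N)$ be $0$ if $M(v)=N(v)$; $-1$ if $p_v(N(v))>p_v(M(v))$; and $+1$ otherwise. A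 matching $M$ is *$\gamma$-popular* (*weakly-popular*) if $\sum_{v\in U\cup W}\mathrm{vote}^\gamma_v(M,N)\ge 0$ (respectively $\sum_{v\in U\cup W}\mathrm{vote}^{weak}_v(M,N)\ge 0$) for every matching $N$. Consider the following algorithm. Replace every edge $e$ by six parallel copies $a(e),b(e),c(e),x(e),y(e),z(e)$. Give every agent a strict linear order on the copies of its incident edges such that agents in $U$ follow the rule $a\succeq^\gamma b\succ c\succ x\succeq^\gamma y\succ z$ and agents in $W$ follow the rule $z\succeq^\gamma y\succ x\succ c\succeq^\gamma b\succ a$. Here, for an agent $v$, $\alpha\succ\beta$ means that $\alpha(e)\succ_v\beta(f)$ for all $e,f\in E(v)$; $\alpha\succeq^\gamma\beta$ means that $\alpha(e)\succ_v\beta(e)$ for all $e\in E(v)$ and that, for all $e,f\in E(v)$, $\beta(f)\succ_v\alpha(e)$ if and only if $p_v(f)\ge p_v(e)+\gamma_f^v$; and within each of the types $a,c,x,z$ the copies are ordered by $p_v$. Everything else (ties, and the order within types $b$ and $y$) is arbitrary. Run the Gale–Shapley algorithm on the copies, with either side proposing, to get a matching $M'$, and output the set $M$ of the edges of $G$ that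 have a copy in $M'$. Such strict orders always exist, and for every choice of them and of the proposing side, $M'$ is a stable matching of the copies and the output $M$ satisfies the following. 1. $M$ is a $\gamma$-popular matching. If the thresholds are small enough, that is, if $p_v(e)>p_v(o)$ implies $p_v(e)\ge p_v(o)+\gamma_e^v$ for all $v$, all $e\in E(v)$ and all $o\in E(v)\cup\{\emptyset\}$, then $M$ is weakly-popular. 2. $|M|\ge\frac23|N|$ for every matching $N$. 3. $|M|\ge\frac34|N|$ for every $\gamma$-popular matching $N$, and in particular for every weakly-popular matching $N$. 4. $|M|\ge\frac45|N|$ for every $\gamma$-min stable matching $N$, and in particular for every weakly stable matching $N$. Consequently a $\gamma$-popular matching always exists, and so does a weakly-popular matching. -/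

import Mathlib

/-- A bipartite graph `(U, W; E)`, parallel edges allowed: `fst e` and `snd e` are the endpoints
of `e` in `U` and in `W`. -/
structure BipGraph (U W E : Type*) where
  fst : E → U
  snd : E → W

namespace BipGraph

variable {U W E : Type*}

/-- The endpoint of `e` in `U` (for `true`) or in `W` (for `false`), as an agent. -/
def endpt (G : BipGraph U W E) : Bool → E → U ⊕ W
  | true, e => Sum.inl (G.fst e)
  | false, e => Sum.inr (G.snd e)

/-- `G.Inc v e`: the edge `e` is incident to the agent `v`, that is, `e ∈ E(v)`. -/
def Inc (G : BipGraph U W E) (v : U ⊕ W) (e : E) : Prop :=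
  ∃ s, G.endpt s e = v

/-- A set of edges is a matching if every agent is incident to at most one of them. -/
def IsMatching (G : BipGraph U W E) (M : Finset E) : Prop :=
  ∀ v, ∀ e ∈ M, ∀ f ∈ M, G.Inc v e → G.Inc v f → e = f

open Classical in
/-- `M(v)`: the edge of `M` at `v`, or `none` if there is none. -/
noncomputable def at_ (G : BipGraph U W E) (M : Finset E) (v : U ⊕ W) : Option E :=
  if h : ∃ e ∈ M, G.Inc v e then some h.choose else none

/-! ### Strict preferences and the Gale–Shapley algorithm

`pref v e f` means that the agent `v` strictly prefers `e` to `f`; only edges incident to `v`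
matter, and being unmatched is worse than any of them. -/

/-- Every agent ranks the incident edges in a strict linear order. -/
structure IsStrictPref (G : BipGraph U W E) (pref : U ⊕ W → E → E → Prop) : Prop where
  irrefl : ∀ v e, G.Inc v e → ¬ pref v e e
  trans : ∀ v e f g, G.Inc v e → G.Inc v f → G.Inc v g → pref v e f → pref v f g → pref v e g
  total : ∀ v e f, G.Inc v e → G.Inc v f → e ≠ f → pref v e f ∨ pref v f e

/-- Stability for strict preferences: no edge outside `M` is preferred by both of its endpoints
to what they have in `M`. -/
def IsStable (G : BipGraph U W E) (pref : U ⊕ W → E → E → Prop) (M : Finset E) : Prop :=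
  G.IsMatching M ∧
    ¬ ∃ e, e ∉ M ∧ ∀ v, G.Inc v e → ∀ f ∈ M, G.Inc v f → pref v e f

section GaleShapley

variable [Fintype E]

open Classical in
/-- The proposals of a round in which the edges of `R` have already been rejected: every agent of
the proposing side `s` proposes its best edge that has not been rejected, if there is one. -/
noncomputable def proposals (G : BipGraph U W E) (pref : U ⊕ W → E → E → Prop) (s : Bool)
    (R : Finset E) : Finset E :=
  Finset.univ.filter fun e =>
    e ∉ R ∧ ∀ f, f ∉ R → G.endpt s f = G.endpt s e → f ≠ e → pref (G.endpt s e) e f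

open Classical in
/-- The proposals that are tentatively held: every agent of the receiving side holds the best
proposal it has got. -/
noncomputable def held (G : BipGraph U W E) (pref : U ⊕ W → E → E → Prop) (s : Bool)
    (R : Finset E) : Finset E :=
  (G.proposals pref s R).filter fun e =>
    ∀ f ∈ G.proposals pref s R,
      G.endpt (!s) f = G.endpt (!s) e → f ≠ e → pref (G.endpt (!s) e) e f

open Classical in
/-- One round of deferred acceptance: the proposals that are not held become rejected. -/
noncomputable def round (G : BipGraph U W E) (pref : U ⊕ W → E → E → Prop) (s : Bool)
    (R : Finset E) : Finset E :=
  R ∪ (G.proposals pref s R \ G.held pref s R)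

/-- The Gale–Shapley algorithm with proposing side `s`. Every round but the last rejects an edge,
so after `|E|` rounds nothing changes any more; the proposals then held are the output. -/
noncomputable def galeShapley (G : BipGraph U W E) (pref : U ⊕ W → E → E → Prop) (s : Bool) :
    Finset E :=
  G.held pref s ((G.round pref s)^[Fintype.card E] ∅)

end GaleShapley

end BipGraph

/-- A matching market: a bipartite graph with preference valuations. `p v (some e)` is `p_v(e)`
(it matters only for edges `e` incident to `v`) and `p v none` is `p_v(∅)`. -/
structure Market (U W E : Type*) extends BipGraph U W E where
  p : U ⊕ W → Option E → ℝ
  p_nonneg : ∀ v e, toBipGraph.Inc v e → 0 ≤ p v (some e)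
  p_none_nonpos : ∀ v, p v none ≤ 0

/-- The six types of copies of an edge. -/
inductive Copy
  | a | b | c | x | y | z
  deriving DecidableEq

instance : Fintype Copy where
  elems := {Copy.a, Copy.b, Copy.c, Copy.x, Copy.y, Copy.z}
  complete k := by cases k <;> simp

namespace Market

variable {U W E : Type*}

/-! ### Stability -/

/-- Weak stability. -/
def IsWeaklyStable (I : Market U W E) (M : Finset E) : Prop :=
  I.IsMatching M ∧
    ¬ ∃ e, e ∉ M ∧ ∀ v, I.Inc v e → I.p v (I.at_ M v) < I.p v (some e)

/-- `γ`-min stability; `γ v e` is `γ_e^v`. -/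
def IsGammaMinStable (I : Market U W E) (γ : U ⊕ W → E → ℝ) (M : Finset E) : Prop :=
  I.IsMatching M ∧
    ¬ ∃ e, e ∉ M ∧ ∀ v, I.Inc v e → I.p v (I.at_ M v) + γ v e ≤ I.p v (some e)

/-! ### Popularity -/

open Classical in
/-- The vote of `v` between `M` and `N` in weak popularity. -/
noncomputable def voteWeak (I : Market U W E) (M N : Finset E) (v : U ⊕ W) : ℤ :=
  if I.at_ M v = I.at_ N v then 0
  else if I.p v (I.at_ M v) < I.p v (I.at_ N v) then -1
  else 1

open Classical in
/-- The vote of `v` between `M` and `N` in `γ`-popularity. An agent that is matched in `M` but not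
in `N` votes for `M`. -/
noncomputable def voteGamma (I : Market U W E) (γ : U ⊕ W → E → ℝ) (M N : Finset E)
    (v : U ⊕ W) : ℤ :=
  if I.at_ M v = I.at_ N v then 0
  else match I.at_ N v with
    | none => 1
    | some e => if I.p v (I.at_ M v) + γ v e ≤ I.p v (some e) then -1 else 1

/-- Weak popularity. -/
def IsWeaklyPopular [Fintype U] [Fintype W] (I : Market U W E) (M : Finset E) : Prop :=
  I.IsMatching M ∧ ∀ N, I.IsMatching N → 0 ≤ ∑ v, I.voteWeak M N v

/-- `γ`-popularity. -/
def IsGammaPopular [Fintype U] [Fintype W] (I : Market U W E) (γ : U ⊕ W → E → ℝ)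
    (M : Finset E) : Prop :=
  I.IsMatching M ∧ ∀ N, I.IsMatching N → 0 ≤ ∑ v, I.voteGamma γ M N v

/-- The thresholds are so small that every strict improvement of an agent reaches them. -/
def IsSmall (I : Market U W E) (γ : U ⊕ W → E → ℝ) : Prop :=
  ∀ v e, I.Inc v e → ∀ o : Option E, (∀ f, o = some f → I.Inc v f) →
    I.p v o < I.p v (some e) → I.p v o + γ v e ≤ I.p v (some e)

/-! ### The algorithm -/

/-- The graph with six parallel copies of every edge. -/
def copies (I : Market U W E) : BipGraph U W (Copy × E) where
  fst d := I.fst d.2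
  snd d := I.snd d.2

/-- `α ≻ β` at `v`. -/
def Above (I : Market U W E) (pref : U ⊕ W → Copy × E → Copy × E → Prop) (v : U ⊕ W)
    (α β : Copy) : Prop :=
  ∀ e f, I.Inc v e → I.Inc v f → pref v (α, e) (β, f)

/-- `α ⪰^γ β` at `v`. -/
def GammaAbove (I : Market U W E) (γ : U ⊕ W → E → ℝ)
    (pref : U ⊕ W → Copy × E → Copy × E → Prop) (v : U ⊕ W) (α β : Copy) : Prop :=
  (∀ e, I.Inc v e → pref v (α, e) (β, e)) ∧
    ∀ e f, I.Inc v e → I.Inc v f →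
      (pref v (β, f) (α, e) ↔ I.p v (some e) + γ v f ≤ I.p v (some f))

/-- At `v` the copies of type `α` are ranked according to `p_v`, with ties broken arbitrarily. -/
def Sorted (I : Market U W E) (pref : U ⊕ W → Copy × E → Copy × E → Prop) (v : U ⊕ W)
    (α : Copy) : Prop :=
  ∀ e f, I.Inc v e → I.Inc v f → I.p v (some f) < I.p v (some e) → pref v (α, e) (α, f)

/-- The ranking of `v` follows the rule `α₁ ⪰^γ β₁ ≻ δ₁ ≻ α₂ ⪰^γ β₂ ≻ δ₂`. -/
def FollowsRule (I : Market U W E) (γ : U ⊕ W → E → ℝ)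
    (pref : U ⊕ W → Copy × E → Copy × E → Prop) (v : U ⊕ W) (α₁ β₁ δ₁ α₂ β₂ δ₂ : Copy) : Prop :=
  I.GammaAbove γ pref v α₁ β₁ ∧ I.Above pref v β₁ δ₁ ∧ I.Above pref v δ₁ α₂ ∧
    I.GammaAbove γ pref v α₂ β₂ ∧ I.Above pref v β₂ δ₂ ∧
    I.Sorted pref v α₁ ∧ I.Sorted pref v δ₁ ∧ I.Sorted pref v α₂ ∧ I.Sorted pref v δ₂

/-- `pref` is one of the strict preference systems on the copies that the algorithm may create;
everything the rules leave open is arbitrary. -/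
structure IsInduced (I : Market U W E) (γ : U ⊕ W → E → ℝ)
    (pref : U ⊕ W → Copy × E → Copy × E → Prop) : Prop where
  strict : I.copies.IsStrictPref pref
  left : ∀ u : U, I.FollowsRule γ pref (Sum.inl u) Copy.a Copy.b Copy.c Copy.x Copy.y Copy.z
  right : ∀ w : W, I.FollowsRule γ pref (Sum.inr w) Copy.z Copy.y Copy.x Copy.c Copy.b Copy.a

open Classical in
/-- The output of the algorithm: the edges with a copy in the Gale–Shapley matching. -/
noncomputable def output [Fintype E] (I : Market U W E)
    (pref : U ⊕ W → Copy × E → Copy × E → Prop) (s : Bool) : Finset E :=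
  (I.copies.galeShapley pref s).image Prod.snd

end Market

/-! ### Matchings, incidence and sums over matched agents -/

namespace BipGraph

variable {U W E : Type*}

/-! Read from its own side, every agent ranks the types as `a`, `b`, `c`, `x`, `y`, `z`, and passing
to the other endpoint of an edge reverses this list. Hence each output edge is upper (`a`, `b` or
`c`) at exactly one endpoint. Beyond the ranking rules, all the guarantees rest only on stability of
`M'`: each of the six copies of an edge outside the output is beaten at one of its endpoints
(`IsInduced.exists_beats`), and different copies give different information.

Popularity is an LP duality argument. The certificate `dual` is 1 at upper agents, -1 at lower ones
and 0 at exposed (unmatched) ones, so it sums to 0. It remains to see that vote plus dual is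
nonnegative on each edge of `N` and at each agent that `N` misses. On an edge with two lower
endpoints, copies `y` and `b` show that neither endpoint gains its threshold; with one lower
endpoint, that not both do; copy `z` settles an exposed endpoint.

The size bounds use a fractional vertex cover (`weight`) of total `|M|` giving every edge of `N` at
least `r`. An agent joined by `N` to an exposed one gets `r`, its partner `1 - r`. By copy `z` such
an agent holds type `a` or `b`, so no output edge has two of them as ends: there are no three-edge
augmenting paths. The critical edges `e` of `N` are those at a partner. There copy `x` shows that
the other endpoint of `e` is upper, or that the output edge `f` at the partner beats the adjacent
edges of `N` by its thresholds at both ends (`IsInduced.isUpper_or_improves`). In the latter case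
`f` blocks a `γ`-min stable `N`; if it happens from both ends of `e`, exchanging along a five-edge
path defeats a `γ`-popular `N` (`IsGammaPopular.not_exchange`). -/

theorem inc_endpt (G : BipGraph U W E) (s : Bool) (e : E) : G.Inc (G.endpt s e) e := ⟨s, rfl⟩

theorem side_eq_of_endpt_eq (G : BipGraph U W E) {s t : Bool} {e f : E}
    (h : G.endpt s e = G.endpt t f) : s = t := by
  cases s <;> cases t <;> simp_all [endpt]

theorem endpt_eq_of_inc (G : BipGraph U W E) {s : Bool} {e f : E}
    (h : G.Inc (G.endpt s e) f) : G.endpt s f = G.endpt s e := by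
  obtain ⟨t, ht⟩ := h
  have := G.side_eq_of_endpt_eq ht
  subst this
  exact ht

theorem IsMatching.eq_of_endpt_eq {G : BipGraph U W E} {M : Finset E} (hM : G.IsMatching M)
    {s : Bool} {e f : E} (he : e ∈ M) (hf : f ∈ M) (h : G.endpt s e = G.endpt s f) : e = f :=
  hM _ e he f hf (G.inc_endpt s e) ⟨s, h.symm⟩

theorem mem_of_at_eq_some {G : BipGraph U W E} {M : Finset E} {v : U ⊕ W} {e : E}
    (h : G.at_ M v = some e) : e ∈ M ∧ G.Inc v e := by
  unfold at_ at h
  split_ifs at h with h'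
  cases h
  exact h'.choose_spec

theorem at_eq_none_iff {G : BipGraph U W E} {M : Finset E} {v : U ⊕ W} :
    G.at_ M v = none ↔ ∀ e ∈ M, ¬ G.Inc v e := by
  unfold at_
  split_ifs with h
  · obtain ⟨e, he, hv⟩ := h
    simp only [false_iff]
    exact fun h => h e he hv
  · push Not at h
    simpa using h

theorem IsMatching.at_eq_some {G : BipGraph U W E} {M : Finset E} (hM : G.IsMatching M)
    {v : U ⊕ W} {e : E} (he : e ∈ M) (hv : G.Inc v e) : G.at_ M v = some e := by
  cases h : G.at_ M v with
  | none => exact absurd hv (at_eq_none_iff.1 h e he)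
  | some f =>
    obtain ⟨hf, hvf⟩ := mem_of_at_eq_some h
    rw [hM v f hf e he hvf hv]

/-- The agents matched by `M`. -/
def Covers (G : BipGraph U W E) (M : Finset E) (v : U ⊕ W) : Prop := ∃ e ∈ M, G.Inc v e

theorem at_eq_none_iff_not_covers {G : BipGraph U W E} {M : Finset E} {v : U ⊕ W} :
    G.at_ M v = none ↔ ¬ G.Covers M v := by
  rw [at_eq_none_iff, Covers]
  push Not
  rfl

theorem covers_endpt_iff {G : BipGraph U W E} {M : Finset E} {s : Bool} {e : E} :
    G.Covers M (G.endpt s e) ↔ ∃ f ∈ M, G.endpt s f = G.endpt s e :=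
  ⟨fun ⟨f, hf, h⟩ => ⟨f, hf, G.endpt_eq_of_inc h⟩, fun ⟨f, hf, h⟩ => ⟨f, hf, s, h⟩⟩

open Classical in
-- A matched agent is the endpoint of exactly one pair (edge of `M`, side). This turns edgewise
-- estimates into estimates over agents.
theorem IsMatching.sum_covers [Fintype U] [Fintype W] {R : Type*} [AddCommMonoid R]
    {G : BipGraph U W E} {M : Finset E} (hM : G.IsMatching M) (F : U ⊕ W → R) :
    ∑ v with G.Covers M v, F v = ∑ e ∈ M, ∑ s, F (G.endpt s e) := by
  rw [← Finset.sum_product']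
  symm
  refine Finset.sum_bij (fun q _ => G.endpt q.2 q.1) ?_ ?_ ?_ (fun _ _ => rfl)
  · rintro ⟨e, s⟩ h
    simp only [Finset.mem_product, Finset.mem_univ, and_true] at h
    simpa using ⟨e, h, G.inc_endpt s e⟩
  · rintro ⟨e, s⟩ h ⟨f, t⟩ h' heq
    simp only [Finset.mem_product, Finset.mem_univ, and_true] at h h'
    have := G.side_eq_of_endpt_eq heq
    dsimp only at this
    subst this
    rw [hM.eq_of_endpt_eq h h' heq]
  · intro v hv
    simp only [Finset.mem_filter, Finset.mem_univ, true_and] at hv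
    obtain ⟨e, he, s, hs⟩ := hv
    exact ⟨(e, s), by simpa using he, hs⟩

/-! ### Stability of the deferred acceptance output -/

section GaleShapley

variable {G : BipGraph U W E} {pref : U ⊕ W → E → E → Prop}

theorem IsStrictPref.asymm (h : G.IsStrictPref pref) {v : U ⊕ W} {e f : E} (he : G.Inc v e)
    (hf : G.Inc v f) (h₁ : pref v e f) (h₂ : pref v f e) : False :=
  h.irrefl v e he (h.trans v e f e he hf he h₁ h₂)

theorem IsStrictPref.exists_best (h : G.IsStrictPref pref) (v : U ⊕ W) (A : Finset E)
    (hA : A.Nonempty) (hinc : ∀ e ∈ A, G.Inc v e) :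
    ∃ e ∈ A, ∀ f ∈ A, f ≠ e → pref v e f := by
  classical
  induction hA using Finset.Nonempty.cons_induction with
  | singleton a => exact ⟨a, by simp, by simp⟩
  | cons a A ha hA ih =>
    obtain ⟨e, he, hbest⟩ := ih fun f hf => hinc f (by simp [hf])
    have hia : G.Inc v a := hinc a (by simp)
    have hie : G.Inc v e := hinc e (by simp [he])
    rcases h.total v a e hia hie (by rintro rfl; exact ha he) with hae | hea
    · refine ⟨a, by simp, fun f hf hfa => ?_⟩
      have hfA : f ∈ A := by simpa [hfa] using hf
      by_cases hfe : f = e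
      · exact hfe ▸ hae
      · exact h.trans v a e f hia hie (hinc f hf) hae (hbest f hfA hfe)
    · refine ⟨e, by simp [he], fun f hf hfe => ?_⟩
      rcases Finset.mem_cons.1 hf with rfl | hfA
      · exact hea
      · exact hbest f hfA hfe

variable [Fintype E] {s : Bool} {R : Finset E}

theorem mem_proposals {e : E} : e ∈ G.proposals pref s R ↔
    e ∉ R ∧ ∀ f, f ∉ R → G.endpt s f = G.endpt s e → f ≠ e → pref (G.endpt s e) e f := by
  simp [proposals]

theorem mem_held {e : E} : e ∈ G.held pref s R ↔ e ∈ G.proposals pref s R ∧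
    ∀ f ∈ G.proposals pref s R,
      G.endpt (!s) f = G.endpt (!s) e → f ≠ e → pref (G.endpt (!s) e) e f := by
  simp [held]

theorem mem_round {e : E} : e ∈ G.round pref s R ↔
    e ∈ R ∨ (e ∈ G.proposals pref s R ∧ e ∉ G.held pref s R) := by
  simp [round]

theorem subset_round : R ⊆ G.round pref s R := fun _ h => mem_round.2 (Or.inl h)

/-- Among the proposals that an agent gets, one is held. -/
theorem IsStrictPref.exists_held (h : G.IsStrictPref pref) {e : E}
    (he : e ∈ G.proposals pref s R) :
    ∃ d ∈ G.held pref s R, G.endpt (!s) d = G.endpt (!s) e ∧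
      (d ≠ e → pref (G.endpt (!s) e) d e) := by
  classical
  obtain ⟨d, hd, hbest⟩ := h.exists_best (G.endpt (!s) e)
    ((G.proposals pref s R).filter fun f => G.endpt (!s) f = G.endpt (!s) e) ⟨e, by simpa using he⟩
    (fun f hf => ⟨!s, (Finset.mem_filter.1 hf).2⟩)
  obtain ⟨hdp, hde⟩ := Finset.mem_filter.1 hd
  refine ⟨d, mem_held.2 ⟨hdp, fun f hf hfd hne => ?_⟩, hde,
    fun hne => hbest e (by simpa using he) hne.symm⟩
  rw [hde]
  exact hbest f (Finset.mem_filter.2 ⟨hf, hfd.trans hde⟩) hne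

/-- A held edge is not rejected, and further rejections only remove its competitors on the proposing
side. -/
theorem held_subset_proposals_round : G.held pref s R ⊆ G.proposals pref s (G.round pref s R) := by
  intro e he
  obtain ⟨h₁, h₂⟩ := mem_proposals.1 (mem_held.1 he).1
  refine mem_proposals.2 ⟨fun h => ?_, fun f hf => h₂ f fun h => hf (subset_round h)⟩
  rcases mem_round.1 h with h | h
  · exact h₁ h
  · exact h.2 he

/-- Every rejected edge is beaten by a current proposal at its receiving agent. -/
def RejectedBeaten (G : BipGraph U W E) (pref : U ⊕ W → E → E → Prop) (s : Bool)
    (R : Finset E) : Prop :=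
  ∀ r ∈ R, ∃ d ∈ G.proposals pref s R, G.endpt (!s) d = G.endpt (!s) r ∧
    pref (G.endpt (!s) r) d r

theorem IsStrictPref.rejectedBeaten_round (h : G.IsStrictPref pref)
    (hR : G.RejectedBeaten pref s R) : G.RejectedBeaten pref s (G.round pref s R) := by
  intro r hr
  rcases mem_round.1 hr with hr | ⟨hr, hr'⟩
  · obtain ⟨d, hd, hdr, hp⟩ := hR r hr
    obtain ⟨g, hg, hgd, hgp⟩ := h.exists_held hd
    refine ⟨g, held_subset_proposals_round hg, hgd.trans hdr, ?_⟩
    by_cases hne : g = d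
    · exact hne ▸ hp
    · rw [hdr] at hgp hgd
      exact h.trans _ g d r ⟨!s, hgd⟩ ⟨!s, hdr⟩ (G.inc_endpt _ _) (hgp hne) hp
  · obtain ⟨g, hg, hgd, hgp⟩ := h.exists_held hr
    exact ⟨g, held_subset_proposals_round hg, hgd, hgp (by rintro rfl; exact hr' hg)⟩

theorem IsStrictPref.rejectedBeaten_iterate (h : G.IsStrictPref pref) (n : ℕ) :
    G.RejectedBeaten pref s ((G.round pref s)^[n] ∅) := by
  induction n with
  | zero => intro r hr; simp at hr
  | succ n ih =>
    rw [Function.iterate_succ_apply']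
    exact h.rejectedBeaten_round ih

/-- A round that changes the rejected set strictly enlarges it, and a fixed point persists. -/
theorem iterate_round_le_card_or_fixed (n : ℕ) :
    n ≤ ((G.round pref s)^[n] ∅).card ∨
      G.round pref s ((G.round pref s)^[n] ∅) = (G.round pref s)^[n] ∅ := by
  induction n with
  | zero => simp
  | succ n ih =>
    rw [Function.iterate_succ_apply']
    rcases ih with ih | ih
    · by_cases hfix : G.round pref s ((G.round pref s)^[n] ∅) = (G.round pref s)^[n] ∅
      · exact Or.inr (by rw [hfix, hfix])
      · have := Finset.card_lt_card (subset_round.ssubset_of_ne (Ne.symm hfix))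
        exact Or.inl (by omega)
    · exact Or.inr (by rw [ih, ih])

theorem round_iterate_card :
    G.round pref s ((G.round pref s)^[Fintype.card E] ∅) = (G.round pref s)^[Fintype.card E] ∅ := by
  rcases iterate_round_le_card_or_fixed (G := G) (pref := pref) (s := s) (Fintype.card E) with h | h
  · have huniv := (Finset.card_eq_iff_eq_univ _).1 (le_antisymm (Finset.card_le_univ _) h)
    rw [huniv]
    exact Finset.eq_univ_iff_forall.2 fun e => subset_round (Finset.mem_univ e)
  · exact h

theorem IsStrictPref.isMatching_held (h : G.IsStrictPref pref) :
    G.IsMatching (G.held pref s R) := by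
  rintro v e he f hf ⟨t, rfl⟩ hvf
  have hfe := G.endpt_eq_of_inc hvf
  by_contra hne
  obtain ⟨he₁, he₂⟩ := mem_held.1 he
  obtain ⟨hf₁, hf₂⟩ := mem_held.1 hf
  refine h.asymm (G.inc_endpt t e) hvf (e := e) (f := f) ?_ ?_
  · rcases Bool.eq_or_eq_not t s with rfl | rfl
    · exact (mem_proposals.1 he₁).2 f (mem_proposals.1 hf₁).1 hfe (Ne.symm hne)
    · exact he₂ f hf₁ hfe (Ne.symm hne)
  · rw [← hfe]
    rcases Bool.eq_or_eq_not t s with rfl | rfl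
    · exact (mem_proposals.1 hf₁).2 e (mem_proposals.1 he₁).1 hfe.symm hne
    · exact hf₂ e he₁ hfe.symm hne

/-- The output of the Gale–Shapley algorithm is stable. -/
theorem IsStrictPref.isStable_galeShapley (h : G.IsStrictPref pref) (s : Bool) :
    G.IsStable pref (G.galeShapley pref s) := by
  classical
  refine ⟨h.isMatching_held, ?_⟩
  unfold galeShapley
  have hfix := round_iterate_card (G := G) (pref := pref) (s := s)
  have hbeat := h.rejectedBeaten_iterate (s := s) (Fintype.card E)
  set R := (G.round pref s)^[Fintype.card E] ∅
  -- At the fixed point no proposal is newly rejected.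
  have hheld : ∀ e ∈ G.proposals pref s R, e ∈ G.held pref s R := by
    intro e he
    by_contra hne
    exact (mem_proposals.1 he).1 (hfix ▸ mem_round.2 (Or.inr ⟨he, hne⟩))
  rintro ⟨e, he, hblock⟩
  -- A rejected edge fails to block at its receiver; an unrejected one fails at its proposer, whose
  -- best remaining edge is held.
  by_cases heR : e ∈ R
  · obtain ⟨d, hd, hde, hp⟩ := hbeat e heR
    exact h.asymm ⟨!s, hde⟩ (G.inc_endpt _ _) hp
      (hblock _ (G.inc_endpt _ _) d (hheld d hd) ⟨!s, hde⟩)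
  · obtain ⟨d, hd, hbest⟩ := h.exists_best (G.endpt s e)
      (Finset.univ.filter fun f => f ∉ R ∧ G.endpt s f = G.endpt s e) ⟨e, by simpa using heR⟩
      (fun f hf => ⟨s, (Finset.mem_filter.1 hf).2.2⟩)
    obtain ⟨-, hdR, hde⟩ := Finset.mem_filter.1 hd
    have hdp : d ∈ G.proposals pref s R := by
      refine mem_proposals.2 ⟨hdR, fun f hf hfd hne => ?_⟩
      rw [hde]
      exact hbest f (by simpa using ⟨hf, hfd.trans hde⟩) hne
    have hne : e ≠ d := by rintro rfl; exact he (hheld _ hdp)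
    exact h.asymm ⟨s, hde⟩ (G.inc_endpt _ _) (hbest e (by simpa using heR) hne)
      (hblock _ (G.inc_endpt _ _) d (hheld d hdp) ⟨s, hde⟩)

end GaleShapley

end BipGraph

/-! ### Types of copies and their reversal -/

namespace Copy

/-- The order-reversing involution of the types. -/
def rev : Copy → Copy
  | a => z
  | b => y
  | c => x
  | x => c
  | y => b
  | z => a

/-- The type `k` seen from side `s`, so that both sides rank the types as `a, b, c, x, y, z`. -/
def seen (s : Bool) (k : Copy) : Copy := if s then k else rev k

theorem rev_rev (k : Copy) : rev (rev k) = k := by cases k <;> rfl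

theorem seen_seen (s : Bool) (k : Copy) : seen s (seen s k) = k := by
  cases s <;> cases k <;> rfl

theorem seen_not (s : Bool) (k : Copy) : seen (!s) k = seen s (rev k) := by
  cases s <;> cases k <;> rfl

/-- The group of types, in the order of preference. -/
def block : Copy → ℕ
  | a => 0
  | b => 0
  | c => 1
  | x => 2
  | y => 2
  | z => 3

/-- Whether the type is one of `b` and `y`, whose values are lowered by the threshold. -/
def lowered : Copy → Bool
  | b => true
  | y => true
  | _ => false

theorem eq_of_block_eq {k l : Copy} (h : block k = block l) (h' : lowered k = lowered l) :
    k = l := by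
  cases k <;> cases l <;> simp_all [block, lowered]

/-- The three better types. -/
def IsUpper (k : Copy) : Prop := k = a ∨ k = b ∨ k = c

theorem isUpper_rev_iff {k : Copy} : IsUpper (rev k) ↔ ¬ IsUpper k := by
  cases k <;> simp [IsUpper, rev]

end Copy

namespace Market

open BipGraph

variable {U W E : Type*} {I : Market U W E} {γ : U ⊕ W → E → ℝ}
  {pref : U ⊕ W → Copy × E → Copy × E → Prop}

theorem endpt_copies (s : Bool) (d : Copy × E) : I.copies.endpt s d = I.endpt s d.2 := by
  cases s <;> rfl

theorem inc_copies {v : U ⊕ W} {d : Copy × E} : I.copies.Inc v d ↔ I.Inc v d.2 := by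
  simp only [BipGraph.Inc, endpt_copies]

/-! ### Existence of induced preferences -/

section Existence

open Copy

/-- The side of an agent. -/
def agentSide : U ⊕ W → Bool
  | Sum.inl _ => true
  | Sum.inr _ => false

/-- The key by which an agent sorts the copies: smaller is better. -/
noncomputable def sortKey [Fintype E] (I : Market U W E) (γ : U ⊕ W → E → ℝ) (v : U ⊕ W)
    (d : Copy × E) : ℕ ×ₗ ℝ ×ₗ ℕ ×ₗ ℕ :=
  let k := seen (agentSide v) d.1
  -- Raising the key of `b` and `y` by the threshold encodes `⪰^γ`. The rule favours the lowered
  -- copy when the threshold is met exactly, so lowered types win ties; the edge index makes the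
  -- order strict.
  toLex (block k, toLex
    ((bif lowered k then γ v d.2 else 0) - I.p v (some d.2), toLex
      ((bif lowered k then 0 else 1), (Fintype.equivFin E d.2 : ℕ))))

theorem sortKey_injective [Fintype E] (v : U ⊕ W) : Function.Injective (I.sortKey γ v) := by
  rintro ⟨k, e⟩ ⟨l, f⟩ h
  simp only [sortKey, EmbeddingLike.apply_eq_iff_eq, Prod.mk.injEq] at h
  obtain ⟨h₁, -, h₂, h₃⟩ := h
  have hkl : seen (agentSide v) k = seen (agentSide v) l := by
    refine eq_of_block_eq h₁ ?_
    cases hk : lowered (seen (agentSide v) k) <;> cases hl : lowered (seen (agentSide v) l) <;>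
      simp [hk, hl] at h₂ ⊢
  have hef : e = f := (Fintype.equivFin E).injective (Fin.ext h₃)
  rw [← seen_seen (agentSide v) k, hkl, seen_seen, hef]

theorem exists_isInduced [Fintype E] (hγ : ∀ v e, I.Inc v e → 0 < γ v e) :
    ∃ pref, I.IsInduced γ pref := by
  refine ⟨fun v d d' => I.sortKey γ v d < I.sortKey γ v d', ⟨?_, ?_, ?_⟩, ?_, ?_⟩
  · exact fun v e _ => lt_irrefl _
  · exact fun v e f g _ _ _ => lt_trans
  · exact fun v e f _ _ hne => lt_or_gt_of_ne ((sortKey_injective v).ne hne)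
  all_goals
    intro v
    refine ⟨⟨fun e he => ?_, fun e f he hf => ?_⟩, fun e f he hf => ?_, fun e f he hf => ?_,
      ⟨fun e he => ?_, fun e f he hf => ?_⟩, fun e f he hf => ?_, fun e f he hf h => ?_,
      fun e f he hf h => ?_, fun e f he hf h => ?_, fun e f he hf h => ?_⟩
  all_goals
    simp only [sortKey, agentSide, seen, rev, block, lowered, Prod.Lex.toLex_lt_toLex, cond_true,
      cond_false, if_true, if_false, Bool.false_eq_true]
    first
    | (simp; done)
    | (have := hγ _ _ he; simp [this]; done)
    | (simp; grind)

end Existence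

/-! ### What beats a copy at an agent -/

namespace IsInduced

open Copy

theorem followsRule (h : I.IsInduced γ pref) (s : Bool) (e : E) :
    I.FollowsRule γ pref (I.endpt s e) (seen s a) (seen s b) (seen s c) (seen s x) (seen s y)
      (seen s z) := by
  cases s
  · exact h.right _
  · exact h.left _

/-- At the endpoint of `e` on side `s`, a copy of `f` beats a copy of `e`; the types are as seen
from that side. -/
def Beats (I : Market U W E) (pref : U ⊕ W → Copy × E → Copy × E → Prop) (s : Bool)
    (k : Copy) (f : E) (j : Copy) (e : E) : Prop :=
  I.endpt s f = I.endpt s e ∧ pref (I.endpt s e) (seen s k, f) (seen s j, e)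

variable {s : Bool} {e f : E} {k : Copy}

theorem pref_of_block_lt (h : I.IsInduced γ pref) {j : Copy} (hs : I.endpt s f = I.endpt s e)
    (hlt : block j < block k) : pref (I.endpt s e) (seen s j, e) (seen s k, f) := by
  have hf : I.Inc (I.endpt s e) f := ⟨s, hs⟩
  have he := I.inc_endpt s e
  have trans := fun k f l g m d (hf : I.Inc (I.endpt s e) f) (hg : I.Inc (I.endpt s e) g)
    (hd : I.Inc (I.endpt s e) d) => h.strict.trans (I.endpt s e) (seen s k, f) (seen s l, g)
      (seen s m, d) (inc_copies.2 hf) (inc_copies.2 hg) (inc_copies.2 hd)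
  -- Within `a, b` and within `x, y` only copies of the same edge are comparable unconditionally, so
  -- the chains change edge only between blocks.
  obtain ⟨⟨hab, -⟩, hbc, hcx, ⟨hxy, -⟩, hyz, -⟩ := h.followsRule s e
  have hxz := trans x e y e z f he he hf (hxy e he) (hyz e f he hf)
  have hcx' := hcx e f he hf
  have hcy := trans c e x f y f he hf hf hcx' (hxy f hf)
  have hcz := trans c e x e z f he he hf (hcx e e he he) hxz
  have hb := fun m => trans b e c e m f he he hf (hbc e e he he)
  have ha := fun m => trans a e b e m f he he hf (hab e he)
  cases j <;> cases k <;> first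
    | (simp [block] at hlt; done)
    | exact hbc e f he hf
    | exact hyz e f he hf
    | assumption
    | exact hb _ ‹_›
    | exact ha _ (hbc e f he hf)
    | exact ha _ (hb _ ‹_›)

theorem block_le_of_beats (h : I.IsInduced γ pref) {j : Copy} (hb : Beats I pref s k f j e) :
    block k ≤ block j := by
  by_contra! hlt
  exact h.strict.asymm (inc_copies.2 ⟨s, hb.1⟩) (inc_copies.2 (I.inc_endpt s e)) hb.2
    (h.pref_of_block_lt hb.1 hlt)

/-- A copy of a type sorted by value is beaten within its type only by edges of no less value. -/
theorem le_of_beats (h : I.IsInduced γ pref) (hk : lowered k = false)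
    (hb : Beats I pref s k f k e) :
    I.p (I.endpt s e) (some e) ≤ I.p (I.endpt s e) (some f) := by
  by_contra! hlt
  have hf : I.Inc (I.endpt s e) f := ⟨s, hb.1⟩
  have he := I.inc_endpt s e
  obtain ⟨-, -, -, -, -, ha, hc, hx, hz⟩ := h.followsRule s e
  refine h.strict.asymm (inc_copies.2 hf) (inc_copies.2 he) hb.2 ?_
  cases k <;> simp only [lowered, Bool.true_eq_false] at hk
  · exact ha e f he hf hlt
  · exact hc e f he hf hlt
  · exact hx e f he hf hlt
  · exact hz e f he hf hlt

theorem beats_a (h : I.IsInduced γ pref) (hb : Beats I pref s k f a e) :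
    (k = a ∧ I.p (I.endpt s e) (some e) ≤ I.p (I.endpt s e) (some f)) ∨
    (k = b ∧ I.p (I.endpt s e) (some e) + γ (I.endpt s e) f ≤ I.p (I.endpt s e) (some f)) := by
  have hle := h.block_le_of_beats hb
  cases k <;> simp only [block, Nat.le_zero_eq, OfNat.ofNat_ne_zero,
    one_ne_zero] at hle
  · exact Or.inl ⟨rfl, h.le_of_beats rfl hb⟩
  · exact Or.inr ⟨rfl, ((h.followsRule s e).1.2 e f (I.inc_endpt s e) ⟨s, hb.1⟩).1 hb.2⟩

/-- The order inside type `b` is arbitrary, yet information survives: if `b(e)` were above `a(f)` it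
would also be above `b(f)`, so either way `b(e)` is not above `a(f)`. -/
theorem beats_b (h : I.IsInduced γ pref) (hb : Beats I pref s k f b e) :
    (k = a ∨ k = b) ∧
      ¬ I.p (I.endpt s e) (some f) + γ (I.endpt s e) e ≤ I.p (I.endpt s e) (some e) := by
  have hle := h.block_le_of_beats hb
  have hf : I.Inc (I.endpt s e) f := ⟨s, hb.1⟩
  have he := I.inc_endpt s e
  obtain ⟨h₁, h₂⟩ := (h.followsRule s e).1
  have key : ¬ pref (I.endpt s e) (seen s b, e) (seen s a, f) := by
    intro hp
    cases k <;> simp only [block, Nat.le_zero_eq, OfNat.ofNat_ne_zero, one_ne_zero] at hle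
    · exact h.strict.asymm (inc_copies.2 hf) (inc_copies.2 he) hb.2 hp
    · exact h.strict.asymm (inc_copies.2 hf) (inc_copies.2 he) hb.2
        (h.strict.trans _ _ _ _ (inc_copies.2 he) (inc_copies.2 hf) (inc_copies.2 hf) hp (h₁ f hf))
  rw [h₂ f e hf he] at key
  cases k <;> simp_all [block]

theorem beats_c (h : I.IsInduced γ pref) (hb : Beats I pref s k f c e) : IsUpper k := by
  have hle := h.block_le_of_beats hb
  cases k <;> simp_all [block, IsUpper]

theorem beats_x (h : I.IsInduced γ pref) (hb : Beats I pref s k f x e) :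
    IsUpper k ∨ k = x ∨
    (k = y ∧ I.p (I.endpt s e) (some e) + γ (I.endpt s e) f ≤ I.p (I.endpt s e) (some f)) := by
  have hle := h.block_le_of_beats hb
  have hiff := (h.followsRule s e).2.2.2.1.2 e f (I.inc_endpt s e) ⟨s, hb.1⟩
  cases k <;> simp only [block, IsUpper, reduceCtorEq, or_true, true_and, false_or,
    false_and, or_false] at hle ⊢
  · exact hiff.1 hb.2
  · omega

theorem beats_y (h : I.IsInduced γ pref) (hb : Beats I pref s k f y e) :
    IsUpper k ∨ ((k = x ∨ k = y) ∧
      ¬ I.p (I.endpt s e) (some f) + γ (I.endpt s e) e ≤ I.p (I.endpt s e) (some e)) := by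
  have hle := h.block_le_of_beats hb
  have hf : I.Inc (I.endpt s e) f := ⟨s, hb.1⟩
  have he := I.inc_endpt s e
  obtain ⟨h₁, h₂⟩ := (h.followsRule s e).2.2.2.1
  by_cases hu : IsUpper k
  · exact Or.inl hu
  have hk : k = x ∨ k = y := by cases k <;> simp_all [block, IsUpper]
  refine Or.inr ⟨hk, ?_⟩
  rw [← h₂ f e hf he]
  intro hp
  rcases hk with rfl | rfl
  · exact h.strict.asymm (inc_copies.2 hf) (inc_copies.2 he) hb.2 hp
  · exact h.strict.asymm (inc_copies.2 hf) (inc_copies.2 he) hb.2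
      (h.strict.trans _ _ _ _ (inc_copies.2 he) (inc_copies.2 hf) (inc_copies.2 hf) hp (h₁ f hf))

end IsInduced

end Market

theorem sum_bool_eq_add_not {R : Type*} [AddCommMonoid R] (F : Bool → R) (s : Bool) :
    ∑ t, F t = F s + F (!s) := by
  cases s <;> simp [add_comm]

namespace Market

open BipGraph Copy IsInduced

variable {U W E : Type*} {I : Market U W E} {γ : U ⊕ W → E → ℝ}
  {pref : U ⊕ W → Copy × E → Copy × E → Prop}

/-! ### The edges of a matching of the copies -/

open Classical in
/-- The edges with a copy in `M'`. -/
noncomputable def edges (M' : Finset (Copy × E)) : Finset E := M'.image Prod.snd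

/-- `M'` contains the copy of `f` whose type is `k` as seen from side `s`. -/
def Has (M' : Finset (Copy × E)) (s : Bool) (k : Copy) (f : E) : Prop := (seen s k, f) ∈ M'

variable {M' : Finset (Copy × E)} {s : Bool} {k l : Copy} {e f g : E}

theorem has_not_rev_iff : Has M' (!s) (rev k) f ↔ Has M' s k f := by
  rw [Has, Has, seen_not, rev_rev]

theorem Has.mem_edges (h : Has M' s k f) : f ∈ edges M' := by
  classical
  exact Finset.mem_image.2 ⟨_, h, rfl⟩

theorem exists_has (s : Bool) (h : f ∈ edges M') : ∃ k, Has M' s k f := by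
  classical
  obtain ⟨⟨k, f⟩, hd, rfl⟩ := Finset.mem_image.1 h
  exact ⟨seen s k, by rwa [Has, seen_seen]⟩

theorem Has.unique (hM : I.copies.IsMatching M') (hk : Has M' s k f) (hl : Has M' s l g)
    (h : I.endpt s f = I.endpt s g) : k = l ∧ f = g := by
  have heq := hM.eq_of_endpt_eq (s := s) hk hl (by simpa only [endpt_copies] using h)
  simp only [Prod.mk.injEq] at heq
  refine ⟨?_, heq.2⟩
  rw [← seen_seen s k, heq.1, seen_seen]

theorem isMatching_edges (hM : I.copies.IsMatching M') : I.IsMatching (edges M') := by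
  rintro v e he f hf ⟨s, rfl⟩ hv
  obtain ⟨k, hk⟩ := exists_has s he
  obtain ⟨l, hl⟩ := exists_has s hf
  exact (hk.unique hM hl (I.endpt_eq_of_inc hv).symm).2

theorem covers_edges_iff : I.Covers (edges M') (I.endpt s e) ↔
    ∃ k f, Has M' s k f ∧ I.endpt s f = I.endpt s e := by
  rw [covers_endpt_iff]
  constructor
  · rintro ⟨f, hf, h⟩
    obtain ⟨k, hk⟩ := exists_has s hf
    exact ⟨k, f, hk, h⟩
  · rintro ⟨k, f, hk, h⟩
    exact ⟨f, hk.mem_edges, h⟩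

/-- A copy of an unmatched edge is beaten at one of its endpoints. -/
theorem IsInduced.exists_beats (h : I.IsInduced γ pref) (hM : I.copies.IsStable pref M')
    (he : e ∉ edges M') (s : Bool) (j : Copy) :
    (∃ k f, Has M' s k f ∧ Beats I pref s k f j e) ∨
    (∃ k f, Has M' (!s) k f ∧ Beats I pref (!s) k f (rev j) e) := by
  have hne : (seen s j, e) ∉ M' := fun h => he (Has.mem_edges (s := s) h)
  by_contra hcon
  refine hM.2 ⟨(seen s j, e), hne, ?_⟩
  rintro _ ⟨t, rfl⟩ ⟨k, f⟩ hf hv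
  have hv' := I.copies.endpt_eq_of_inc hv
  have hfe : I.endpt t f = I.endpt t e := by simpa only [endpt_copies] using hv'
  rcases h.strict.total _ _ _ (I.copies.inc_endpt t (seen s j, e)) hv
    (by rintro heq; exact hne (heq ▸ hf)) with hp | hp
  · exact hp
  · refine absurd ?_ hcon
    rw [endpt_copies] at hp
    rcases Bool.eq_or_eq_not t s with rfl | rfl
    · exact Or.inl ⟨seen t k, f, by rwa [Has, seen_seen], hfe, by rwa [seen_seen]⟩
    · exact Or.inr ⟨seen (!s) k, f, by rwa [Has, seen_seen], hfe,
        by rwa [seen_seen, seen_not, rev_rev]⟩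

theorem IsInduced.beats_or_beats (h : I.IsInduced γ pref) (hM : I.copies.IsStable pref M')
    (he : e ∉ edges M') (hk : Has M' s k f) (hf : I.endpt s f = I.endpt s e)
    (hl : Has M' (!s) l g) (hg : I.endpt (!s) g = I.endpt (!s) e) (j : Copy) :
    Beats I pref s k f j e ∨ Beats I pref (!s) l g (rev j) e := by
  rcases h.exists_beats hM he s j with ⟨k', f', hk', hb⟩ | ⟨k', f', hk', hb⟩
  · obtain ⟨rfl, rfl⟩ := hk.unique hM.1 hk' (hf.trans hb.1.symm)
    exact Or.inl hb
  · obtain ⟨rfl, rfl⟩ := hl.unique hM.1 hk' (hg.trans hb.1.symm)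
    exact Or.inr hb

/-- The copy of type `z` seen from the exposed endpoint has the top type `a` at the other endpoint,
where it must be beaten. -/
theorem IsInduced.exists_of_not_covers (h : I.IsInduced γ pref) (hM : I.copies.IsStable pref M')
    (hc : ¬ I.Covers (edges M') (I.endpt s e)) :
    ∃ k f, Has M' (!s) k f ∧ I.endpt (!s) f = I.endpt (!s) e ∧
      ((k = a ∧ I.p (I.endpt (!s) e) (some e) ≤ I.p (I.endpt (!s) e) (some f)) ∨
      (k = b ∧ I.p (I.endpt (!s) e) (some e) + γ (I.endpt (!s) e) f
        ≤ I.p (I.endpt (!s) e) (some f))) := by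
  have he : e ∉ edges M' := fun h => hc ⟨e, h, I.inc_endpt s e⟩
  rcases h.exists_beats hM he s z with ⟨k, f, hk, hb⟩ | ⟨k, f, hk, hb⟩
  · exact absurd (covers_edges_iff.2 ⟨k, f, hk, hb.1⟩) hc
  · exact ⟨k, f, hk, hb.1, h.beats_a hb⟩

/-- The agent `v` is matched by a copy of one of the three types it likes better. -/
def Upper (I : Market U W E) (M' : Finset (Copy × E)) (v : U ⊕ W) : Prop :=
  ∃ s k f, Has M' s k f ∧ I.endpt s f = v ∧ IsUpper k

theorem Has.upper_iff (hM : I.copies.IsMatching M') (hk : Has M' s k f)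
    (hf : I.endpt s f = I.endpt s e) : I.Upper M' (I.endpt s e) ↔ IsUpper k := by
  constructor
  · rintro ⟨t, l, g, hl, hg, hu⟩
    obtain rfl := I.side_eq_of_endpt_eq hg
    obtain ⟨rfl, rfl⟩ := hk.unique hM hl (hf.trans hg.symm)
    exact hu
  · exact fun hu => ⟨s, k, f, hk, hf, hu⟩

/-! ### Votes -/

theorem neg_one_le_voteGamma (M N : Finset E) (v : U ⊕ W) : -1 ≤ I.voteGamma γ M N v := by
  unfold voteGamma
  split_ifs
  · simp
  · split
    · simp
    · split_ifs <;> simp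

theorem voteGamma_le_one (M N : Finset E) (v : U ⊕ W) : I.voteGamma γ M N v ≤ 1 := by
  unfold voteGamma
  split_ifs
  · simp
  · split
    · simp
    · split_ifs <;> simp

theorem voteGamma_of_at_eq {M N : Finset E} {v : U ⊕ W} (h : I.at_ M v = I.at_ N v) :
    I.voteGamma γ M N v = 0 := by
  rw [voteGamma, if_pos h]

theorem voteGamma_of_none {M N : Finset E} {v : U ⊕ W} (hM : I.at_ M v ≠ none)
    (hN : I.at_ N v = none) : I.voteGamma γ M N v = 1 := by
  rw [voteGamma, if_neg (by rwa [hN]), hN]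

open Classical in
theorem voteGamma_of_some {M N : Finset E} {v : U ⊕ W} {e : E} (hM : I.at_ M v ≠ some e)
    (hN : I.at_ N v = some e) :
    I.voteGamma γ M N v = if I.p v (I.at_ M v) + γ v e ≤ I.p v (some e) then -1 else 1 := by
  rw [voteGamma, if_neg (by rwa [hN]), hN]

/-- The dual certificate for popularity. -/
noncomputable def dual (I : Market U W E) (M' : Finset (Copy × E)) (v : U ⊕ W) : ℤ :=
  open Classical in if I.Covers (edges M') v then if I.Upper M' v then 1 else -1 else 0

theorem Has.dual_eq (hM : I.copies.IsMatching M') (hk : Has M' s k f)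
    (hf : I.endpt s f = I.endpt s e) :
    I.dual M' (I.endpt s e) = open Classical in if IsUpper k then 1 else -1 := by
  classical
  rw [dual, if_pos (covers_edges_iff.2 ⟨k, f, hk, hf⟩)]
  exact if_congr (hk.upper_iff hM hf) rfl rfl

theorem neg_one_le_dual (v : U ⊕ W) : -1 ≤ I.dual M' v := by
  unfold dual
  split_ifs <;> simp

theorem dual_of_not_covers {v : U ⊕ W} (h : ¬ I.Covers (edges M') v) : I.dual M' v = 0 := by
  rw [dual, if_neg h]

theorem sum_dual_endpt (hM : I.copies.IsMatching M') (hf : f ∈ edges M') :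
    ∑ s, I.dual M' (I.endpt s f) = 0 := by
  obtain ⟨k, hk⟩ := exists_has true hf
  rw [sum_bool_eq_add_not _ true, hk.dual_eq hM rfl, (has_not_rev_iff.2 hk).dual_eq hM rfl]
  have hrev := isUpper_rev_iff (k := k)
  split_ifs <;> first | rfl | tauto

theorem sum_dual [Fintype U] [Fintype W] (hM : I.copies.IsMatching M') :
    ∑ v, I.dual M' v = 0 := by
  classical
  rw [← Finset.sum_filter_of_ne (p := I.Covers (edges M'))
    (fun v _ hv => by_contra fun h => hv (dual_of_not_covers h)),
    (isMatching_edges hM).sum_covers]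
  exact Finset.sum_eq_zero fun f hf => sum_dual_endpt hM hf

theorem voteGamma_edges (hM : I.copies.IsMatching M') {N : Finset E} (hN : I.IsMatching N)
    (heN : e ∈ N) (he : e ∉ edges M') (hk : Has M' s k f) (hf : I.endpt s f = I.endpt s e) :
    I.voteGamma γ (edges M') N (I.endpt s e) = open Classical in
      if I.p (I.endpt s e) (some f) + γ (I.endpt s e) e ≤ I.p (I.endpt s e) (some e)
      then -1 else 1 := by
  have hat := (isMatching_edges hM).at_eq_some hk.mem_edges ⟨s, hf⟩
  rw [voteGamma_of_some (e := e) _ (hN.at_eq_some heN (I.inc_endpt s e)), hat]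
  rw [hat]
  rintro ⟨⟩
  exact he hk.mem_edges

/-- The exposed endpoint costs at most 1; the other one is upper and does not gain from `e`, so it
contributes 1 + 1. -/
theorem IsInduced.sum_vote_add_dual_of_not_covers (hγ : ∀ v e, I.Inc v e → 0 < γ v e)
    (h : I.IsInduced γ pref)
    (hM : I.copies.IsStable pref M') {N : Finset E} (hN : I.IsMatching N) (heN : e ∈ N)
    (hc : ¬ I.Covers (edges M') (I.endpt s e)) :
    0 ≤ ∑ t, (I.voteGamma γ (edges M') N (I.endpt t e) + I.dual M' (I.endpt t e)) := by
  have he : e ∉ edges M' := fun h => hc ⟨e, h, I.inc_endpt s e⟩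
  obtain ⟨k, f, hk, hf, hkf⟩ := h.exists_of_not_covers hM hc
  have hu : IsUpper k := by rcases hkf with ⟨rfl, -⟩ | ⟨rfl, -⟩ <;> simp [IsUpper]
  have hle : I.p (I.endpt (!s) e) (some e) ≤ I.p (I.endpt (!s) e) (some f) := by
    rcases hkf with ⟨-, h⟩ | ⟨-, h⟩
    · exact h
    · linarith [hγ _ f ⟨!s, hf⟩]
  rw [sum_bool_eq_add_not _ s, dual_of_not_covers hc, hk.dual_eq hM.1 hf, if_pos hu,
    voteGamma_edges hM.1 hN heN he hk hf, if_neg]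
  · linarith [neg_one_le_voteGamma (I := I) (γ := γ) (edges M') N (I.endpt s e)]
  · linarith [hγ _ e (I.inc_endpt (!s) e)]

/-- Copy `y` of `e` has type `b` at the other endpoint, where a lower type cannot beat it; so it is
beaten here. -/
theorem IsInduced.not_improves_of_not_upper (h : I.IsInduced γ pref)
    (hM : I.copies.IsStable pref M') (he : e ∉ edges M') (hk : Has M' s k f)
    (hf : I.endpt s f = I.endpt s e) (hl : Has M' (!s) l g)
    (hg : I.endpt (!s) g = I.endpt (!s) e) (hku : ¬ IsUpper k) (hlu : ¬ IsUpper l) :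
    ¬ I.p (I.endpt s e) (some f) + γ (I.endpt s e) e ≤ I.p (I.endpt s e) (some e) := by
  rcases h.beats_or_beats hM he hk hf hl hg y with hb | hb
  · exact ((h.beats_y hb).resolve_left hku).2
  · refine absurd ?_ hlu
    rcases (h.beats_b hb).1 with rfl | rfl <;> simp [IsUpper]

/-- Copy `b` of `e` has type `y` at the lower endpoint; wherever it is beaten, that endpoint does
not gain its threshold. -/
theorem IsInduced.not_both_improve (h : I.IsInduced γ pref)
    (hM : I.copies.IsStable pref M') (he : e ∉ edges M') (hk : Has M' s k f)
    (hf : I.endpt s f = I.endpt s e) (hl : Has M' (!s) l g)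
    (hg : I.endpt (!s) g = I.endpt (!s) e) (hlu : ¬ IsUpper l) :
    ¬ (I.p (I.endpt s e) (some f) + γ (I.endpt s e) e ≤ I.p (I.endpt s e) (some e) ∧
      I.p (I.endpt (!s) e) (some g) + γ (I.endpt (!s) e) e ≤ I.p (I.endpt (!s) e) (some e)) := by
  rintro ⟨h₁, h₂⟩
  rcases h.beats_or_beats hM he hk hf hl hg b with hb | hb
  · exact (h.beats_b hb).2 h₁
  · exact ((h.beats_y hb).resolve_left hlu).2 h₂

theorem IsInduced.sum_vote_add_dual (hγ : ∀ v e, I.Inc v e → 0 < γ v e)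
    (h : I.IsInduced γ pref)
    (hM : I.copies.IsStable pref M') {N : Finset E} (hN : I.IsMatching N) (heN : e ∈ N) :
    0 ≤ ∑ t, (I.voteGamma γ (edges M') N (I.endpt t e) + I.dual M' (I.endpt t e)) := by
  by_cases he : e ∈ edges M'
  · rw [Finset.sum_add_distrib, sum_dual_endpt hM.1 he, add_zero]
    refine (Finset.sum_eq_zero fun t _ => voteGamma_of_at_eq ?_).ge
    rw [hN.at_eq_some heN (I.inc_endpt t e),
      (isMatching_edges hM.1).at_eq_some he (I.inc_endpt t e)]
  by_cases hc : I.Covers (edges M') (I.endpt true e)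
  swap
  · exact h.sum_vote_add_dual_of_not_covers hγ hM hN heN hc
  by_cases hc' : I.Covers (edges M') (I.endpt false e)
  swap
  · exact h.sum_vote_add_dual_of_not_covers hγ hM hN heN hc'
  obtain ⟨k, f, hk, hf⟩ := covers_edges_iff.1 hc
  obtain ⟨l, g, hl, hg⟩ := covers_edges_iff.1 hc'
  rw [Fintype.sum_bool, voteGamma_edges hM.1 hN heN he hk hf, voteGamma_edges hM.1 hN heN he hl hg,
    hk.dual_eq hM.1 hf, hl.dual_eq hM.1 hg]
  have h₁ := h.not_improves_of_not_upper hM he hk hf hl hg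
  have h₂ := h.not_improves_of_not_upper hM he hl hg hk hf
  have h₃ := h.not_both_improve hM he hk hf hl hg
  have h₄ := h.not_both_improve hM he hl hg hk hf
  simp only [Bool.not_true, Bool.not_false] at h₁ h₂ h₃ h₄
  -- Two upper endpoints have dual sum 2, which absorbs any votes; with one, the duals cancel and so
  -- do the votes at worst; with none, both votes are 1.
  split_ifs <;> first | (norm_num; done) | tauto

/-- A stable matching of the copies yields a `γ`-popular matching. -/
theorem IsInduced.isGammaPopular [Fintype U] [Fintype W]
    (hγ : ∀ v e, I.Inc v e → 0 < γ v e) (h : I.IsInduced γ pref)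
    (hM : I.copies.IsStable pref M') : I.IsGammaPopular γ (edges M') := by
  classical
  refine ⟨isMatching_edges hM.1, fun N hN => ?_⟩
  have hsum : ∑ v, I.voteGamma γ (edges M') N v
      = ∑ v, (I.voteGamma γ (edges M') N v + I.dual M' v) := by
    rw [Finset.sum_add_distrib, sum_dual hM.1, add_zero]
  rw [hsum, ← Finset.sum_filter_add_sum_filter_not _ (I.Covers N), hN.sum_covers]
  refine add_nonneg (Finset.sum_nonneg fun e he => h.sum_vote_add_dual hγ hM hN he)
    (Finset.sum_nonneg fun v hv => ?_)
  have hNv := at_eq_none_iff_not_covers.2 (Finset.mem_filter.1 hv).2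
  by_cases hMv : I.at_ (edges M') v = none
  · rw [voteGamma_of_at_eq (hMv.trans hNv.symm),
      dual_of_not_covers (at_eq_none_iff_not_covers.1 hMv), add_zero]
  · rw [voteGamma_of_none hMv hNv]
    linarith [neg_one_le_dual (I := I) (M' := M') v]

/-! ### Weak notions versus `γ`-notions -/

theorem voteWeak_le_voteGamma (hγ : ∀ v e, I.Inc v e → 0 < γ v e)
    {M N : Finset E} (v : U ⊕ W) :
    I.voteWeak M N v ≤ I.voteGamma γ M N v := by
  by_cases heq : I.at_ M v = I.at_ N v
  · rw [voteWeak, if_pos heq, voteGamma_of_at_eq heq]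
  cases hNv : I.at_ N v with
  | none =>
    rw [voteGamma_of_none (hNv ▸ heq) hNv, voteWeak]
    split_ifs <;> simp
  | some e =>
    have hγe := hγ v e (mem_of_at_eq_some hNv).2
    rw [voteGamma_of_some (hNv ▸ heq) hNv, voteWeak, if_neg heq, hNv]
    split_ifs <;> linarith

theorem voteGamma_le_voteWeak (hsmall : I.IsSmall γ) {M N : Finset E} (v : U ⊕ W) :
    I.voteGamma γ M N v ≤ I.voteWeak M N v := by
  by_cases heq : I.at_ M v = I.at_ N v
  · rw [voteWeak, if_pos heq, voteGamma_of_at_eq heq]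
  rw [voteWeak, if_neg heq]
  split_ifs with hlt
  swap
  · exact voteGamma_le_one M N v
  cases hNv : I.at_ N v with
  | none =>
    rw [hNv] at hlt heq
    obtain ⟨f, hf⟩ := Option.ne_none_iff_exists'.1 heq
    rw [hf] at hlt
    -- Becoming unmatched is never a strict improvement, by the sign conventions on values.
    linarith [I.p_none_nonpos v, I.p_nonneg v f (mem_of_at_eq_some hf).2]
  | some e =>
    rw [hNv] at hlt heq
    rw [voteGamma_of_some heq hNv, if_pos]
    exact hsmall v e (mem_of_at_eq_some hNv).2 _ (fun f hf => (mem_of_at_eq_some hf).2) hlt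

theorem IsWeaklyPopular.isGammaPopular [Fintype U] [Fintype W]
    (hγ : ∀ v e, I.Inc v e → 0 < γ v e) {M : Finset E}
    (h : I.IsWeaklyPopular M) : I.IsGammaPopular γ M :=
  ⟨h.1, fun N hN => (h.2 N hN).trans (Finset.sum_le_sum fun v _ => voteWeak_le_voteGamma hγ v)⟩

theorem IsGammaPopular.isWeaklyPopular [Fintype U] [Fintype W] {M : Finset E}
    (h : I.IsGammaPopular γ M) (hsmall : I.IsSmall γ) : I.IsWeaklyPopular M :=
  ⟨h.1, fun N hN => (h.2 N hN).trans (Finset.sum_le_sum fun v _ => voteGamma_le_voteWeak hsmall v)⟩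

theorem IsWeaklyStable.isGammaMinStable (hγ : ∀ v e, I.Inc v e → 0 < γ v e)
    {M : Finset E} (h : I.IsWeaklyStable M) :
    I.IsGammaMinStable γ M :=
  ⟨h.1, fun ⟨e, he, hb⟩ => h.2 ⟨e, he, fun v hv => by linarith [hb v hv, hγ v e hv]⟩⟩

theorem exists_isSmall [Fintype U] [Fintype W] [Fintype E] (I : Market U W E) :
    ∃ γ : U ⊕ W → E → ℝ, (∀ v e, 0 < γ v e) ∧ I.IsSmall γ := by
  classical
  -- The constant threshold is the least positive difference of values; 1 only keeps the set
  -- nonempty.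
  let S : Finset ℝ := insert 1 (((Finset.univ : Finset ((U ⊕ W) × E × Option E)).image
    fun q => I.p q.1 (some q.2.1) - I.p q.1 q.2.2).filter (0 < ·))
  have hS : S.Nonempty := ⟨1, by simp [S]⟩
  have hpos : 0 < S.min' hS := by
    rw [Finset.lt_min'_iff]
    intro r hr
    rcases Finset.mem_insert.1 hr with rfl | hr
    · exact one_pos
    · exact (Finset.mem_filter.1 hr).2
  refine ⟨fun _ _ => S.min' hS, fun _ _ => hpos, fun v e _ o _ hlt => ?_⟩
  have := S.min'_le (I.p v (some e) - I.p v o) (Finset.mem_insert_of_mem (Finset.mem_filter.2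
    ⟨Finset.mem_image.2 ⟨(v, e, o), Finset.mem_univ _, rfl⟩, sub_pos.2 hlt⟩))
  linarith

end Market

namespace Market

open BipGraph Copy IsInduced

variable {U W E : Type*} {I : Market U W E} {γ : U ⊕ W → E → ℝ}
  {pref : U ⊕ W → Copy × E → Copy × E → Prop} {M' : Finset (Copy × E)} {N : Finset E}
  {s : Bool} {k l : Copy} {e f g : E}

/-! ### Fractional vertex covers -/

/-- The agent `v` is the second agent of an `M`-augmenting path that starts with an edge of `N`. -/
def NextToExposed (I : Market U W E) (M N : Finset E) (v : U ⊕ W) : Prop :=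
  ∃ s e, e ∈ N ∧ I.endpt s e = v ∧ ¬ I.Covers M (I.endpt (!s) e)

/-- The partner of `v` in `M` is next to an exposed agent. -/
def PartnerNextToExposed (I : Market U W E) (M N : Finset E) (v : U ⊕ W) : Prop :=
  ∃ s f, f ∈ M ∧ I.endpt s f = v ∧ I.NextToExposed M N (I.endpt (!s) f)

theorem partnerNextToExposed_iff {M : Finset E} (hM : I.IsMatching M) (hf : f ∈ M)
    (hfe : I.endpt s f = I.endpt s e) :
    I.PartnerNextToExposed M N (I.endpt s e) ↔ I.NextToExposed M N (I.endpt (!s) f) := by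
  constructor
  · rintro ⟨t, g, hg, hge, h⟩
    obtain rfl := I.side_eq_of_endpt_eq hge
    rwa [hM.eq_of_endpt_eq hf hg (hfe.trans hge.symm)]
  · exact fun h => ⟨s, f, hf, hfe, h⟩

theorem IsInduced.exists_of_nextToExposed (h : I.IsInduced γ pref)
    (hM : I.copies.IsStable pref M') (hk : Has M' s k f)
    (hx : I.NextToExposed (edges M') N (I.endpt s f)) :
    ∃ d ∈ N, I.endpt s d = I.endpt s f ∧ ¬ I.Covers (edges M') (I.endpt (!s) d) ∧
      (k = a ∨ (k = b ∧ I.p (I.endpt s f) (some d) + γ (I.endpt s f) f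
        ≤ I.p (I.endpt s f) (some f))) := by
  obtain ⟨t, d, hd, hdf, hc⟩ := hx
  obtain rfl := I.side_eq_of_endpt_eq hdf
  obtain ⟨l, g, hl, hg, hlg⟩ := h.exists_of_not_covers hM hc
  rw [Bool.not_not] at hl hg hlg
  obtain ⟨rfl, rfl⟩ := hk.unique hM.1 hl (hdf.symm.trans hg.symm)
  rw [← hdf]
  exact ⟨d, hd, rfl, hc, hlg.imp And.left id⟩

theorem IsInduced.isUpper_of_nextToExposed (h : I.IsInduced γ pref)
    (hM : I.copies.IsStable pref M') (hk : Has M' s k f)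
    (hx : I.NextToExposed (edges M') N (I.endpt s f)) : IsUpper k := by
  obtain ⟨-, -, -, -, rfl | ⟨rfl, -⟩⟩ := h.exists_of_nextToExposed hM hk hx <;> simp [IsUpper]

open Classical in
/-- A weight function whose total is the size of the matching: `h` next to exposed agents and
`m` at the other agents that are matched by a better type. -/
noncomputable def weight (I : Market U W E) (M' : Finset (Copy × E)) (N : Finset E) (h m : ℝ)
    (v : U ⊕ W) : ℝ :=
  if ¬ I.Covers (edges M') v then 0
  else if I.NextToExposed (edges M') N v then h
  else if I.PartnerNextToExposed (edges M') N v then 1 - h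
  else if I.Upper M' v then m
  else 1 - m

variable {r m : ℝ}

open Classical in
theorem Has.weight_eq (hM : I.copies.IsMatching M') (hk : Has M' s k f)
    (hf : I.endpt s f = I.endpt s e) :
    I.weight M' N r m (I.endpt s e) =
      if I.NextToExposed (edges M') N (I.endpt s e) then r
      else if I.NextToExposed (edges M') N (I.endpt (!s) f) then 1 - r
      else if IsUpper k then m else 1 - m := by
  rw [weight, if_neg (not_not.2 (covers_edges_iff.2 ⟨k, f, hk, hf⟩))]
  refine if_congr Iff.rfl rfl (if_congr ?_ rfl (if_congr (hk.upper_iff hM hf) rfl rfl))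
  exact partnerNextToExposed_iff (isMatching_edges hM) hk.mem_edges hf

theorem weight_of_not_covers {v : U ⊕ W} (h : ¬ I.Covers (edges M') v) :
    I.weight M' N r m v = 0 := by
  rw [weight, if_pos h]

theorem weight_nonneg (hr : 0 ≤ r) (hr' : r ≤ 1) (hm : 0 ≤ m) (hm' : m ≤ 1) (v : U ⊕ W) :
    0 ≤ I.weight M' N r m v := by
  unfold weight
  split_ifs <;> linarith

/-- Agents next to exposed ones are upper, and only one endpoint of an output edge is, so the
weights `r` and `1 - r`, or `m` and `1 - m`, always come in pairs. -/
theorem IsInduced.sum_weight_endpt (h : I.IsInduced γ pref) (hM : I.copies.IsStable pref M')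
    (hf : f ∈ edges M') : ∑ s, I.weight M' N r m (I.endpt s f) = 1 := by
  obtain ⟨k, hk⟩ := exists_has true hf
  have hk' := has_not_rev_iff.2 hk
  rw [sum_bool_eq_add_not _ true, hk.weight_eq hM.1 rfl, hk'.weight_eq hM.1 rfl]
  have h₁ := h.isUpper_of_nextToExposed (N := N) hM hk
  have h₂ := h.isUpper_of_nextToExposed (N := N) hM hk'
  rw [isUpper_rev_iff] at h₂
  have hrev := isUpper_rev_iff (k := k)
  split_ifs <;> first | (ring; done) | tauto

theorem IsInduced.sum_weight [Fintype U] [Fintype W] (h : I.IsInduced γ pref)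
    (hM : I.copies.IsStable pref M') :
    ∑ v, I.weight M' N r m v = (edges M').card := by
  classical
  rw [← Finset.sum_filter_of_ne (p := I.Covers (edges M'))
    (fun v _ hv => by_contra fun h => hv (weight_of_not_covers h)),
    (isMatching_edges hM.1).sum_covers,
    Finset.sum_congr rfl fun f hf => h.sum_weight_endpt hM hf]
  simp

theorem IsInduced.le_sum_weight_of_not_covers (h : I.IsInduced γ pref)
    (hM : I.copies.IsStable pref M') (he : e ∈ N)
    (hc : ¬ I.Covers (edges M') (I.endpt s e)) :
    r ≤ ∑ t, I.weight M' N r m (I.endpt t e) := by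
  obtain ⟨k, f, hk, hf, -⟩ := h.exists_of_not_covers hM hc
  rw [sum_bool_eq_add_not _ s, weight_of_not_covers hc, hk.weight_eq hM.1 hf, if_pos, zero_add]
  exact ⟨!s, e, he, rfl, by rwa [Bool.not_not]⟩

/-- If the edges of `N` between matched agents have weight at least `r`, then the matching
obtained from `M'` has at least `r` times the size of `N`. -/
theorem IsInduced.mul_card_le [Fintype U] [Fintype W] (h : I.IsInduced γ pref)
    (hM : I.copies.IsStable pref M') (hN : I.IsMatching N) (hr : 0 ≤ r) (hr' : r ≤ 1)
    (hm : 0 ≤ m) (hm' : m ≤ 1)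
    (hw : ∀ e ∈ N, e ∉ edges M' → ∀ k f l g, Has M' true k f → I.endpt true f = I.endpt true e →
      Has M' false l g → I.endpt false g = I.endpt false e →
      r ≤ I.weight M' N r m (I.endpt true e) + I.weight M' N r m (I.endpt false e)) :
    r * N.card ≤ (edges M').card := by
  classical
  have hedge : ∀ e ∈ N, r ≤ ∑ t, I.weight M' N r m (I.endpt t e) := by
    intro e heN
    by_cases he : e ∈ edges M'
    · rwa [h.sum_weight_endpt hM he]
    by_cases hc : I.Covers (edges M') (I.endpt true e)
    swap
    · exact h.le_sum_weight_of_not_covers hM heN hc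
    by_cases hc' : I.Covers (edges M') (I.endpt false e)
    swap
    · exact h.le_sum_weight_of_not_covers hM heN hc'
    obtain ⟨k, f, hk, hf⟩ := covers_edges_iff.1 hc
    obtain ⟨l, g, hl, hg⟩ := covers_edges_iff.1 hc'
    rw [Fintype.sum_bool]
    exact hw e heN he k f l g hk hf hl hg
  calc r * N.card = ∑ _e ∈ N, r := by rw [Finset.sum_const, nsmul_eq_mul, mul_comm]
    _ ≤ ∑ e ∈ N, ∑ t, I.weight M' N r m (I.endpt t e) := Finset.sum_le_sum hedge
    _ = ∑ v with I.Covers N v, I.weight M' N r m v := (hN.sum_covers _).symm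
    _ ≤ ∑ v, I.weight M' N r m v := Finset.sum_le_sum_of_subset_of_nonneg (Finset.filter_subset _ _)
        fun v _ _ => weight_nonneg hr hr' hm hm' v
    _ = (edges M').card := h.sum_weight hM

/-- Matched agents have weights 2/3, 1/3 and 1/2, so even the worst pair 1/3 + 1/3 suffices. -/
theorem IsInduced.two_thirds_mul_card_le [Fintype U] [Fintype W] (h : I.IsInduced γ pref)
    (hM : I.copies.IsStable pref M') (hN : I.IsMatching N) :
    (2 / 3 : ℝ) * N.card ≤ (edges M').card := by
  refine h.mul_card_le hM (m := 1 / 2) hN (by norm_num) (by norm_num) (by norm_num) (by norm_num)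
    fun e _ _ k f l g hk hf hl hg => ?_
  rw [hk.weight_eq hM.1 hf, hl.weight_eq hM.1 hg]
  split_ifs <;> norm_num

/-- An edge of `N` that is the third edge of an augmenting path. -/
theorem IsInduced.isUpper_or_improves (h : I.IsInduced γ pref)
    (hM : I.copies.IsStable pref M') (he : e ∉ edges M') (hk : Has M' s k f)
    (hf : I.endpt s f = I.endpt s e) (hl : Has M' (!s) l g)
    (hg : I.endpt (!s) g = I.endpt (!s) e)
    (hx : I.NextToExposed (edges M') N (I.endpt (!s) f)) :
    IsUpper l ∨ (I.p (I.endpt s e) (some e) + γ (I.endpt s e) f ≤ I.p (I.endpt s e) (some f) ∧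
      ∃ d ∈ N, I.endpt (!s) d = I.endpt (!s) f ∧ ¬ I.Covers (edges M') (I.endpt s d) ∧
        I.p (I.endpt (!s) f) (some d) + γ (I.endpt (!s) f) f ≤ I.p (I.endpt (!s) f) (some f)) := by
  obtain ⟨d, hd, hdf, hc, hd'⟩ := h.exists_of_nextToExposed hM (has_not_rev_iff.2 hk) hx
  rw [Bool.not_not] at hc
  have hk' := rev_rev k
  -- Copy `x` at side `s` is copy `c` at the other side. The type of `f` from side `s` is `z` or
  -- `y`: `z` never beats `x`, and `y` does so only by the threshold.
  rcases h.beats_or_beats hM he hk hf hl hg x with hb | hb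
  · rcases hd' with hr | ⟨hr, himp⟩ <;> rw [hr] at hk' <;> subst hk'
    · simpa [rev, IsUpper] using h.beats_x hb
    · have := h.beats_x hb
      simp only [rev, IsUpper, reduceCtorEq, or_self, true_and, false_or] at this
      exact Or.inr ⟨this, d, hd, hdf, hc, himp⟩
  · exact Or.inl (h.beats_c hb)

/-- The better types do not occur at partners of agents next to exposed ones. -/
theorem IsInduced.not_isUpper_of_nextToExposed (h : I.IsInduced γ pref)
    (hM : I.copies.IsStable pref M') (hk : Has M' s k f)
    (hx : I.NextToExposed (edges M') N (I.endpt (!s) f)) : ¬ IsUpper k :=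
  isUpper_rev_iff.1 (h.isUpper_of_nextToExposed hM (has_not_rev_iff.2 hk) hx)

theorem IsInduced.isUpper_of_isGammaMinStable (h : I.IsInduced γ pref)
    (hM : I.copies.IsStable pref M') (hN : I.IsGammaMinStable γ N) (heN : e ∈ N)
    (he : e ∉ edges M') (hk : Has M' s k f)
    (hf : I.endpt s f = I.endpt s e) (hl : Has M' (!s) l g)
    (hg : I.endpt (!s) g = I.endpt (!s) e)
    (hx : I.NextToExposed (edges M') N (I.endpt (!s) f)) : IsUpper l := by
  refine (h.isUpper_or_improves hM he hk hf hl hg hx).resolve_right ?_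
  rintro ⟨himp, d, hd, hdf, hc, himp'⟩
  -- `f` blocks `N`: it beats `e` at one end and `d` at the other.
  refine hN.2 ⟨f, fun hfN => ?_, ?_⟩
  · rw [hN.1.eq_of_endpt_eq hd hfN hdf] at hc
    exact hc ⟨f, hk.mem_edges, I.inc_endpt s f⟩
  · rintro _ ⟨t, rfl⟩
    rcases Bool.eq_or_eq_not t s with rfl | rfl
    · rw [hf, hN.1.at_eq_some heN (I.inc_endpt t e)]
      exact himp
    · rw [hN.1.at_eq_some hd ⟨!s, hdf⟩]
      exact himp'

/-- The weights are 4/5, 1/5, 3/5 and 2/5. An endpoint of weight 1/5 faces an upper one, of weight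
at least 3/5; all other pairs reach 2/5 + 2/5. -/
theorem IsInduced.four_fifths_mul_card_le [Fintype U] [Fintype W] (h : I.IsInduced γ pref)
    (hM : I.copies.IsStable pref M') (hN : I.IsGammaMinStable γ N) :
    (4 / 5 : ℝ) * N.card ≤ (edges M').card := by
  refine h.mul_card_le hM (m := 3 / 5) hN.1 (by norm_num) (by norm_num) (by norm_num) (by norm_num)
    fun e heN he k f l g hk hf hl hg => ?_
  rw [hk.weight_eq hM.1 hf, hl.weight_eq hM.1 hg]
  have h₁ := h.isUpper_of_isGammaMinStable hM hN heN he hk hf hl hg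
  have h₂ := h.isUpper_of_isGammaMinStable hM hN heN he hl hg hk hf
  have h₃ := h.not_isUpper_of_nextToExposed (N := N) hM hk
  have h₄ := h.not_isUpper_of_nextToExposed (N := N) hM hl
  split_ifs <;> first | (norm_num; done) | tauto

/-! ### Exchange along an augmenting path with three edges -/

/-- A `γ`-popular matching `N` has no five-edge path whose inner agents all gain by switching to
the two edges outside `N` and whose ends are exposed by a matching `M` containing these edges. -/
theorem IsGammaPopular.not_exchange [Fintype U] [Fintype W] {M : Finset E} {d₁ d₂ : E}
    (hN : I.IsGammaPopular γ N) (hM : I.IsMatching M) (he : e ∈ N) (heM : e ∉ M)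
    (hf : f ∈ M) (hg : g ∈ M) (hd₁ : d₁ ∈ N) (hd₂ : d₂ ∈ N)
    (hfe : I.endpt s f = I.endpt s e) (hge : I.endpt (!s) g = I.endpt (!s) e)
    (hdf : I.endpt (!s) d₁ = I.endpt (!s) f) (hdg : I.endpt s d₂ = I.endpt s g)
    (hc₁ : ¬ I.Covers M (I.endpt s d₁)) (hc₂ : ¬ I.Covers M (I.endpt (!s) d₂))
    (h₁ : I.p (I.endpt s e) (some e) + γ (I.endpt s e) f ≤ I.p (I.endpt s e) (some f))
    (h₂ : I.p (I.endpt (!s) e) (some e) + γ (I.endpt (!s) e) g ≤ I.p (I.endpt (!s) e) (some g))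
    (h₃ : I.p (I.endpt (!s) f) (some d₁) + γ (I.endpt (!s) f) f ≤ I.p (I.endpt (!s) f) (some f))
    (h₄ : I.p (I.endpt s g) (some d₂) + γ (I.endpt s g) g ≤ I.p (I.endpt s g) (some g)) :
    False := by
  classical
  have hd₁M : d₁ ∉ M := fun h => hc₁ ⟨d₁, h, I.inc_endpt _ _⟩
  have hd₂M : d₂ ∉ M := fun h => hc₂ ⟨d₂, h, I.inc_endpt _ _⟩
  -- If `f = g`, then `d₁ = e`, whose endpoint on side `s` is covered by `f`.
  have hfg : f ≠ g := by
    rintro rfl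
    have := hN.1.eq_of_endpt_eq hd₁ he (hdf.trans hge)
    subst this
    exact hc₁ ⟨f, hf, s, hfe⟩
  let N' : Finset E := N.filter (fun d => d ≠ e ∧ d ≠ d₁ ∧ d ≠ d₂) ∪ {f, g}
  have hmem : ∀ d, d ∈ N' ↔ (d ∈ N ∧ d ≠ e ∧ d ≠ d₁ ∧ d ≠ d₂) ∨ d = f ∨ d = g := by
    intro d
    simp only [N', Finset.mem_union, Finset.mem_filter, Finset.mem_insert, Finset.mem_singleton]
  -- The endpoints of `f` and `g` are all occupied in `N` by `e`, `d₁` and `d₂`, so the kept edges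
  -- avoid them.
  have hMN : ∀ t, ∀ d ∈ N, (d ≠ e ∧ d ≠ d₁ ∧ d ≠ d₂) → ∀ d', (d' = f ∨ d' = g) →
      I.endpt t d ≠ I.endpt t d' := by
    rintro t d hd ⟨hn, hn₁, hn₂⟩ d' hd' heq
    rcases Bool.eq_or_eq_not t s with rfl | rfl <;> rcases hd' with rfl | rfl
    · exact hn (hN.1.eq_of_endpt_eq hd he (heq.trans hfe))
    · exact hn₂ (hN.1.eq_of_endpt_eq hd hd₂ (heq.trans hdg.symm))
    · exact hn₁ (hN.1.eq_of_endpt_eq hd hd₁ (heq.trans hdf.symm))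
    · exact hn (hN.1.eq_of_endpt_eq hd he (heq.trans hge))
  have hN' : I.IsMatching N' := by
    rintro _ d hd d' hd' ⟨t, rfl⟩ hv
    have heq := I.endpt_eq_of_inc hv
    rcases (hmem d).1 hd with ⟨hdN, hdn⟩ | hd <;> rcases (hmem d').1 hd' with ⟨hdN', hdn'⟩ | hd'
    · exact hN.1.eq_of_endpt_eq hdN hdN' heq.symm
    · exact absurd heq.symm (hMN t d hdN hdn d' hd')
    · exact absurd heq (hMN t d' hdN' hdn' d hd)
    · refine hM.eq_of_endpt_eq (s := t) ?_ ?_ heq.symm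
      · rcases hd with rfl | rfl <;> assumption
      · rcases hd' with rfl | rfl <;> assumption
  have hfN' : f ∈ N' := (hmem f).2 (Or.inr (Or.inl rfl))
  have hgN' : g ∈ N' := (hmem g).2 (Or.inr (Or.inr rfl))
  have hloss : ∀ t d c, d ∈ N → d ∉ M → c ∈ N' → c ∈ M → I.endpt t d = I.endpt t c →
      I.p (I.endpt t c) (some d) + γ (I.endpt t c) c ≤ I.p (I.endpt t c) (some c) →
      I.voteGamma γ N N' (I.endpt t c) = -1 := by
    intro t d c hd hdM hcN hcM hdc himp
    have hat := hN.1.at_eq_some hd ⟨t, hdc⟩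
    rw [voteGamma_of_some (e := c) _ (hN'.at_eq_some hcN (I.inc_endpt t c)), hat, if_pos himp]
    rw [hat]
    rintro ⟨⟩
    exact hdM hcM
  have hv₁ := hloss s e f he heM hfN' hf hfe.symm (by rwa [hfe])
  have hv₂ := hloss (!s) e g he heM hgN' hg hge.symm (by rwa [hge])
  have hv₃ := hloss (!s) d₁ f hd₁ hd₁M hfN' hf hdf h₃
  have hv₄ := hloss s d₂ g hd₂ hd₂M hgN' hg hdg h₄
  have hsides : ∀ c d : E, I.endpt s c ≠ I.endpt (!s) d := fun c d h => by
    have := I.side_eq_of_endpt_eq h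
    simp at this
  have hne : ∀ t, I.endpt t f ≠ I.endpt t g := fun t h => hfg (hM.eq_of_endpt_eq hf hg h)
  have hexp : ∀ t, ∀ c ∈ M, ∀ v, ¬ I.Covers M v → v ≠ I.endpt t c := by
    rintro t c hc v hv rfl
    exact hv ⟨c, hc, I.inc_endpt t c⟩
  -- The four inner agents vote -1, the two path ends at most 1, and all others keep their edge; the
  -- total is at most 2 - 4 < 0.
  have hbound : ∀ v, I.voteGamma γ N N' v ≤
      (if v = I.endpt s d₁ then 1 else 0) + (if v = I.endpt (!s) d₂ then 1 else 0)
      - (if v = I.endpt s f then 1 else 0) - (if v = I.endpt (!s) f then 1 else 0)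
      - (if v = I.endpt s g then 1 else 0) - (if v = I.endpt (!s) g then 1 else 0) := by
    intro v
    by_cases e₁ : v = I.endpt s f
    · subst e₁
      simp [hv₁, hsides, hne, (hexp s f hf _ hc₁).symm]
    by_cases e₂ : v = I.endpt (!s) f
    · subst e₂
      simp [hv₃, (hsides _ _).symm, hne, (hexp (!s) f hf _ hc₂).symm]
    by_cases e₃ : v = I.endpt s g
    · subst e₃
      simp [hv₄, hsides, (hne _).symm, (hexp s g hg _ hc₁).symm]
    by_cases e₄ : v = I.endpt (!s) g
    · subst e₄
      simp [hv₂, (hsides _ _).symm, (hne _).symm, (hexp (!s) g hg _ hc₂).symm]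
    have hle := voteGamma_le_one (I := I) (γ := γ) N N' v
    simp only [e₁, e₂, e₃, e₄, if_false, sub_zero]
    by_cases e₅ : v = I.endpt s d₁
    · rw [if_pos e₅]
      split_ifs <;> linarith
    by_cases e₆ : v = I.endpt (!s) d₂
    · rw [if_pos e₆]
      split_ifs
      linarith
    rw [if_neg e₅, if_neg e₆, voteGamma_of_at_eq, add_zero]
    cases hNv : I.at_ N v with
    | none =>
      symm
      rw [at_eq_none_iff] at hNv ⊢
      rintro c hc ⟨t, rfl⟩
      rcases (hmem c).1 hc with ⟨hcN, -⟩ | rfl | rfl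
      · exact hNv c hcN (I.inc_endpt t c)
      · rcases Bool.eq_or_eq_not t s with rfl | rfl <;> simp_all
      · rcases Bool.eq_or_eq_not t s with rfl | rfl <;> simp_all
    | some c =>
      obtain ⟨hcN, hvc⟩ := mem_of_at_eq_some hNv
      refine (hN'.at_eq_some ((hmem c).2 (Or.inl ⟨hcN, ?_⟩)) hvc).symm
      obtain ⟨t, rfl⟩ := hvc
      refine ⟨?_, ?_, ?_⟩ <;> rintro rfl <;> rcases Bool.eq_or_eq_not t s with rfl | rfl <;>
        first
        | exact e₁ hfe.symm
        | exact e₄ hge.symm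
        | exact e₅ rfl
        | exact e₂ hdf
        | exact e₃ hdg
        | exact e₆ rfl
  have hsum := (hN.2 N' hN').trans (Finset.sum_le_sum fun v _ => hbound v)
  simp only [Finset.sum_sub_distrib, Finset.sum_add_distrib, Finset.sum_ite_eq', Finset.mem_univ,
    if_true] at hsum
  norm_num at hsum

/-- With weights 3/4, 1/4 and 1/2, only 1/4 + 1/4 falls short. That pair is the middle edge of a
five-edge augmenting path, excluded by the exchange. -/
theorem IsInduced.three_quarters_mul_card_le [Fintype U] [Fintype W] (h : I.IsInduced γ pref)
    (hM : I.copies.IsStable pref M') (hN : I.IsGammaPopular γ N) :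
    (3 / 4 : ℝ) * N.card ≤ (edges M').card := by
  refine h.mul_card_le hM (m := 1 / 2) hN.1 (by norm_num) (by norm_num) (by norm_num) (by norm_num)
    fun e heN he k f l g hk hf hl hg => ?_
  rw [hk.weight_eq hM.1 hf, hl.weight_eq hM.1 hg]
  have hbad : ¬ (I.NextToExposed (edges M') N (I.endpt (!true) f) ∧
      I.NextToExposed (edges M') N (I.endpt (!false) g)) := by
    rintro ⟨hx, hx'⟩
    obtain ⟨h₁, d₁, hd₁, hdf, hc₁, h₃⟩ :=
      (h.isUpper_or_improves hM he hk hf hl hg hx).resolve_left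
        (h.not_isUpper_of_nextToExposed hM hl hx')
    obtain ⟨h₂, d₂, hd₂, hdg, hc₂, h₄⟩ :=
      (h.isUpper_or_improves hM he hl hg hk hf hx').resolve_left
        (h.not_isUpper_of_nextToExposed hM hk hx)
    exact hN.not_exchange (isMatching_edges hM.1) heN he hk.mem_edges hl.mem_edges hd₁ hd₂ hf hg
      hdf hdg hc₁ hc₂ h₁ h₂ h₃ h₄
  split_ifs <;> first | (norm_num; done) | tauto

end Market

/-! ### The main theorem -/

theorem mainTheorem1 {U W E : Type*} [Fintype U] [Fintype W] [Fintype E] (I : Market U W E) :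
    (∃ M, I.IsWeaklyPopular M) ∧
    ∀ γ : U ⊕ W → E → ℝ, (∀ v e, I.Inc v e → 0 < γ v e) →
      (∃ M, I.IsGammaPopular γ M) ∧
      (∃ pref, I.IsInduced γ pref) ∧
      ∀ pref, I.IsInduced γ pref → ∀ s : Bool,
        I.copies.IsStable pref (I.copies.galeShapley pref s) ∧
        I.IsGammaPopular γ (I.output pref s) ∧
        (I.IsSmall γ → I.IsWeaklyPopular (I.output pref s)) ∧
        (∀ N, I.IsMatching N → (2 / 3 : ℝ) * N.card ≤ (I.output pref s).card) ∧
        (∀ N, I.IsGammaPopular γ N → (3 / 4 : ℝ) * N.card ≤ (I.output pref s).card) ∧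
        (∀ N, I.IsWeaklyPopular N → (3 / 4 : ℝ) * N.card ≤ (I.output pref s).card) ∧
        (∀ N, I.IsGammaMinStable γ N → (4 / 5 : ℝ) * N.card ≤ (I.output pref s).card) ∧
        (∀ N, I.IsWeaklyStable N → (4 / 5 : ℝ) * N.card ≤ (I.output pref s).card) := by
  have hpop : ∀ γ : U ⊕ W → E → ℝ, (∀ v e, I.Inc v e → 0 < γ v e) → ∀ pref,
      I.IsInduced γ pref → ∀ s, I.IsGammaPopular γ (I.output pref s) := fun γ hγ pref h s =>
    h.isGammaPopular hγ (h.strict.isStable_galeShapley s)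
  refine ⟨?_, fun γ hγ => ⟨?_, Market.exists_isInduced hγ, fun pref h s => ?_⟩⟩
  · obtain ⟨γ, hγ, hsmall⟩ := I.exists_isSmall
    obtain ⟨pref, h⟩ := Market.exists_isInduced (I := I) fun v e _ => hγ v e
    exact ⟨_, (hpop γ (fun v e _ => hγ v e) pref h true).isWeaklyPopular hsmall⟩
  · obtain ⟨pref, h⟩ := Market.exists_isInduced hγ
    exact ⟨_, hpop γ hγ pref h true⟩
  · have hM := h.strict.isStable_galeShapley s
    exact ⟨hM, hpop γ hγ pref h s, (hpop γ hγ pref h s).isWeaklyPopular,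
      fun N hN => h.two_thirds_mul_card_le hM hN,
      fun N hN => h.three_quarters_mul_card_le hM hN,
      fun N hN => h.three_quarters_mul_card_le hM (hN.isGammaPopular hγ),
      fun N hN => h.four_fifths_mul_card_le hM hN,
      fun N hN => h.four_fifths_mul_card_le hM (hN.isGammaMinStable hγ)⟩
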